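/- **Syntax.** Let $\Sigma$ be a set of actions and $T$ a finite set of primitive tests. Boolean expressions are given by $b,c ::= 0 \mid 1 \mid t\in T \mid b\cdot c \mid b+c \mid \bar b$, and GKAT expressions by $e,f ::= p\in\Sigma \mid b \mid e\cdot f \mid e+_b f \mid e^{(b)}$; every Boolean expression is a GKAT expression, and on Boolean expressions the two products $\cdot$ are the same operation. Let $\equiv_{\mathrm{BA}}$ be equivalence of Boolean expressions by the axioms of Boolean algebra. **Language model.** Let $\mathrm{At}$ be the set of atoms (truth assignments on $T$), with $\alpha\le b$ if $b$ is true under $\alpha$. Guarded strings are the words $\alpha_0p_1\alpha_1\cdots p_n\alpha_n$ with $\alpha_i\in\mathrm{At}$, $p_i\in\Sigma$; $x\alpha\diamond\beta y = x\alpha y$ if $\alpha=\beta$ and is undefined otherwise, and $L\diamond K=\{x\diamond y : x\in L,\ y\in K\}$, $L^0=\mathrm{At}$, $L^{n+1}=L^n\diamond L$. Put $⟦p⟧=\{\alpha p\beta : \alpha,\beta\in\mathrm{At}\}$, $⟦b⟧=\{\alpha\in\mathrm{At} : \alpha\le b\}$, $⟦e\cdot f⟧=⟦e⟧\diamond⟦f⟧$,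 $⟦e+_bf⟧=(⟦b⟧\diamond⟦e⟧)\cup(⟦\bar b⟧\diamond⟦f⟧)$, $⟦e^{(b)}⟧=\bigcup_{n\ge0}(⟦b⟧\diamond⟦e⟧)^n\diamond⟦\bar b⟧$. **Axioms.** Let $E(b)=b$, $E(p)=0$, $E(e\cdot f)=E(e)\cdot E(f)$, $E(e+_bf)=b\cdot E(e)+\bar b\cdot E(f)$, $E(e^{(b)})=\bar b$. The GKAT axioms for a congruence $\equiv$ on GKAT expressions are: $b\equiv_{\mathrm{BA}}c$ implies $b\equiv c$; $e+_be\equiv e$; $e+_bf\equiv f+_{\bar b}e$; $(e+_bf)+_cg\equiv e+_{bc}(f+_cg)$; $e+_bf\equiv be+_bf$; $eg+_bfg\equiv(e+_bf)g$; $(ef)g\equiv e(fg)$; $0e\equiv0$; $e0\equiv0$; $1e\equiv e$; $e1\equiv e$; $e^{(b)}\equiv ee^{(b)}+_b1$; $(e+_c1)^{(b)}\equiv(ce)^{(b)}$; and if $E(e)\equiv0$ and $g\equiv eg+_bf$, then $g\equiv e^{(b)}f$. **Uniqueness axiom.** A system of left-affine equations consists of equations $x_i=e_{i1}x_1+_{b_{i1}}(\cdots+_{b_{i(n-1)}}(e_{in}x_n+_{b_{in}}d_i))$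 for $1\le i\le n$, with GKAT expressions $e_{ij}$ and Boolean expressions $b_{ij},d_i$ such that $b_{ij}b_{ik}\equiv_{\mathrm{BA}}0$ for $j\ne k$ and $b_{ij}d_i\equiv_{\mathrm{BA}}0$. A solution assigns to each $x_i$ an expression $s(x_i)$ such that all equations hold up to $\equiv$. The system is Salomaa if $E(e_{ij})\equiv0$ for all $i,j$. The uniqueness axiom for $\equiv$ says: if $s$ and $s'$ are solutions of a Salomaa system, then $s(x_i)\equiv s'(x_i)$ for all $i$. **Theorem (Completeness).** The GKAT axioms together with the uniqueness axiom are complete for the language model: if $\equiv$ is the smallest congruence on GKAT expressions that satisfies the GKAT axioms and the uniqueness axiom, then for all $e_1,e_2$, $$⟦e_1⟧=⟦e_2⟧\ \Longrightarrow\ e_1\equiv e_2 .$$ Likewise, if the smallest congruence $\equiv$ that satisfies the GKAT axioms alone happens to satisfy the uniqueness axiom, then $⟦e_1⟧=⟦e_2⟧$ implies $e_1\equiv e_2$ for all $e_1,e_2$. -/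

import Mathlib

namespace GKAT

universe u v

/-! ### Syntax -/

/-- Boolean expressions over the primitive tests `T`. -/
inductive BExp (T : Type v) : Type v
  | zero : BExp T
  | one : BExp T
  | prim (t : T) : BExp T
  | and (b c : BExp T) : BExp T
  | or (b c : BExp T) : BExp T
  | not (b : BExp T) : BExp T

/-- GKAT expressions over the actions `A` and the primitive tests `T`.
`cond b e f` is the guarded union `e +_b f`, and `loop b e` is the guarded loop `e^(b)`. -/
inductive Exp (A : Type u) (T : Type v) : Type (max u v)
  | act (p : A) : Exp A T
  | test (b : BExp T) : Exp A T
  | seq (e f : Exp A T) : Exp A T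
  | cond (b : BExp T) (e f : Exp A T) : Exp A T
  | loop (b : BExp T) (e : Exp A T) : Exp A T

/-- Boolean equivalence: the smallest congruence on Boolean expressions that satisfies the
axioms of Boolean algebra (complemented distributive lattices). -/
inductive BAEquiv {T : Type v} : BExp T → BExp T → Prop
  | refl (b : BExp T) : BAEquiv b b
  | symm {b c : BExp T} : BAEquiv b c → BAEquiv c b
  | trans {b c d : BExp T} : BAEquiv b c → BAEquiv c d → BAEquiv b d
  | and_congr {b b' c c' : BExp T} :
      BAEquiv b b' → BAEquiv c c' → BAEquiv (.and b c) (.and b' c')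
  | or_congr {b b' c c' : BExp T} :
      BAEquiv b b' → BAEquiv c c' → BAEquiv (.or b c) (.or b' c')
  | not_congr {b b' : BExp T} : BAEquiv b b' → BAEquiv (.not b) (.not b')
  | and_comm (b c : BExp T) : BAEquiv (.and b c) (.and c b)
  | or_comm (b c : BExp T) : BAEquiv (.or b c) (.or c b)
  | and_assoc (b c d : BExp T) : BAEquiv (.and (.and b c) d) (.and b (.and c d))
  | or_assoc (b c d : BExp T) : BAEquiv (.or (.or b c) d) (.or b (.or c d))
  | and_absorb (b c : BExp T) : BAEquiv (.and b (.or b c)) b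
  | or_absorb (b c : BExp T) : BAEquiv (.or b (.and b c)) b
  | and_distrib (b c d : BExp T) :
      BAEquiv (.and b (.or c d)) (.or (.and b c) (.and b d))
  | or_distrib (b c d : BExp T) :
      BAEquiv (.or b (.and c d)) (.and (.or b c) (.or b d))
  | and_one (b : BExp T) : BAEquiv (.and b .one) b
  | or_zero (b : BExp T) : BAEquiv (.or b .zero) b
  | and_not (b : BExp T) : BAEquiv (.and b (.not b)) .zero
  | or_not (b : BExp T) : BAEquiv (.or b (.not b)) .one

/-! ### The language model -/

/-- Atoms of the free Boolean algebra on the finite set `T`, as truth assignments on `T`. -/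
abbrev Atom (T : Type v) : Type v := T → Bool

/-- `BExp.eval α b = true` says that the atom `α` lies below `b`. -/
def BExp.eval {T : Type v} (α : Atom T) : BExp T → Bool
  | .zero => false
  | .one => true
  | .prim t => α t
  | .and b c => b.eval α && c.eval α
  | .or b c => b.eval α || c.eval α
  | .not b => !(b.eval α)

/-- Guarded strings `α₀ p₁ α₁ ⋯ pₙ αₙ`, stored as `first = α₀` and
`steps = [(p₁, α₁), …, (pₙ, αₙ)]`. -/
@[ext]
structure GString (A : Type u) (T : Type v) : Type (max u v) where
  first : Atom T
  steps : List (A × Atom T)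

/-- The last atom of a guarded string. -/
def GString.last {A : Type u} {T : Type v} (w : GString A T) : Atom T :=
  w.steps.foldl (fun _ s => s.2) w.first

/-- The guarded string consisting of a single atom. -/
def GString.ofAtom {A : Type u} {T : Type v} (α : Atom T) : GString A T := ⟨α, []⟩

/-- Languages of guarded strings. -/
abbrev Lang (A : Type u) (T : Type v) : Type (max u v) := Set (GString A T)

/-- The set of guarded strings given by a set of atoms. -/
def Lang.ofAtoms {A : Type u} {T : Type v} (B : Set (Atom T)) : Lang A T :=
  GString.ofAtom '' B

/-- Fusion product of languages: `xα ⋄ βy` is `xαy` if `α = β` and undefined otherwise. -/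
def Lang.fusion {A : Type u} {T : Type v} (L K : Lang A T) : Lang A T :=
  {w | ∃ x ∈ L, ∃ y ∈ K, x.last = y.first ∧ w = ⟨x.first, x.steps ++ y.steps⟩}

/-- Powers with respect to the fusion product: `L⁰ = At` and `Lⁿ⁺¹ = Lⁿ ⋄ L`. -/
def Lang.power {A : Type u} {T : Type v} (L : Lang A T) : ℕ → Lang A T
  | 0 => Lang.ofAtoms Set.univ
  | n + 1 => (Lang.power L n).fusion L

/-- Guarded union of languages: `L +_B K = (B ⋄ L) ∪ (Bᶜ ⋄ K)`. -/
def Lang.cond {A : Type u} {T : Type v} (B : Set (Atom T)) (L K : Lang A T) : Lang A T :=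
  (Lang.ofAtoms B).fusion L ∪ (Lang.ofAtoms Bᶜ).fusion K

/-- Guarded iteration of languages: `L^(B) = ⋃ₙ (B ⋄ L)ⁿ ⋄ Bᶜ`. -/
def Lang.loop {A : Type u} {T : Type v} (B : Set (Atom T)) (L : Lang A T) : Lang A T :=
  ⋃ n : ℕ, (((Lang.ofAtoms B).fusion L).power n).fusion (Lang.ofAtoms Bᶜ)

/-- The set of atoms below a Boolean expression. -/
def BExp.atoms {T : Type v} (b : BExp T) : Set (Atom T) := {α | b.eval α = true}

/-- The language semantics `⟦e⟧` of a GKAT expression. -/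
def Exp.sem {A : Type u} {T : Type v} : Exp A T → Lang A T
  | .act p => {w | ∃ α β : Atom T, w = ⟨α, [(p, β)]⟩}
  | .test b => Lang.ofAtoms b.atoms
  | .seq e f => e.sem.fusion f.sem
  | .cond b e f => Lang.cond b.atoms e.sem f.sem
  | .loop b e => Lang.loop b.atoms e.sem

/-! ### The axioms -/

/-- The Boolean expression `E(e)`: the weakest test under which `e` terminates successfully
without performing an action. -/
def Exp.E {A : Type u} {T : Type v} : Exp A T → BExp T
  | .act _ => .zero
  | .test b => b
  | .seq e f => .and e.E f.E
  | .cond b e f => .or (.and b e.E) (.and (.not b) f.E)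
  | .loop b _ => .not b

/-- `R` is a congruence on GKAT expressions that subsumes Boolean equivalence and satisfies the
GKAT axioms (U1–U5, S1–S5, W1–W3). Boolean expressions form a subset of the GKAT expressions on
which the conjunction of tests and sequential composition are one and the same operation; as
`Exp.test` is a constructor here, this is the clause `test_seq`. -/
structure IsGKATCongruence {A : Type u} {T : Type v} (R : Exp A T → Exp A T → Prop) : Prop where
  equivalence : Equivalence R
  seq_congr : ∀ {e e' f f'}, R e e' → R f f' → R (.seq e f) (.seq e' f')
  cond_congr : ∀ {b e e' f f'}, R e e' → R f f' → R (.cond b e f) (.cond b e' f')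
  loop_congr : ∀ {b e e'}, R e e' → R (.loop b e) (.loop b e')
  test_of_baEquiv : ∀ {b c}, BAEquiv b c → R (.test b) (.test c)
  test_seq : ∀ b c, R (.seq (.test b) (.test c)) (.test (.and b c))
  u1 : ∀ b e, R (.cond b e e) e
  u2 : ∀ b e f, R (.cond b e f) (.cond (.not b) f e)
  u3 : ∀ b c e f g, R (.cond c (.cond b e f) g) (.cond (.and b c) e (.cond c f g))
  u4 : ∀ b e f, R (.cond b e f) (.cond b (.seq (.test b) e) f)
  u5 : ∀ b e f g, R (.cond b (.seq e g) (.seq f g)) (.seq (.cond b e f) g)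
  s1 : ∀ e f g, R (.seq (.seq e f) g) (.seq e (.seq f g))
  s2 : ∀ e, R (.seq (.test .zero) e) (.test .zero)
  s3 : ∀ e, R (.seq e (.test .zero)) (.test .zero)
  s4 : ∀ e, R (.seq (.test .one) e) e
  s5 : ∀ e, R (.seq e (.test .one)) e
  w1 : ∀ b e, R (.loop b e) (.cond b (.seq e (.loop b e)) (.test .one))
  w2 : ∀ b c e, R (.loop b (.cond c e (.test .one))) (.loop b (.seq (.test c) e))
  w3 : ∀ {b e f g}, R (.test e.E) (.test .zero) →
    R g (.cond b (.seq e g) f) → R g (.seq (.loop b e) f)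

/-- `e ≡ f`: the smallest congruence that subsumes Boolean equivalence and satisfies the GKAT
axioms. -/
def GEquiv {A : Type u} {T : Type v} (e f : Exp A T) : Prop :=
  ∀ R : Exp A T → Exp A T → Prop, IsGKATCongruence R → R e f

/-! ### Systems of left-affine equations -/

/-- A system of `n` left-affine equations in the variables `x₁, …, xₙ`,
`xᵢ = eᵢ₁ x₁ +_{bᵢ₁} (⋯ +_{bᵢ₍ₙ₋₁₎} (eᵢₙ xₙ +_{bᵢₙ} dᵢ))`,
where in every row the guards are pairwise disjoint. -/
structure LeftAffineSystem (A : Type u) (T : Type v) (n : ℕ) : Type (max u v) where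
  coeff : Fin n → Fin n → Exp A T
  guard : Fin n → Fin n → BExp T
  const : Fin n → BExp T
  guard_disjoint : ∀ i j k, j ≠ k → BAEquiv (.and (guard i j) (guard i k)) .zero
  const_disjoint : ∀ i j, BAEquiv (.and (guard i j) (const i)) .zero

/-- The right-hand side of the `i`-th equation with `s j` substituted for the `j`-th variable. -/
def LeftAffineSystem.rhs {A : Type u} {T : Type v} {n : ℕ} (S : LeftAffineSystem A T n)
    (s : Fin n → Exp A T) (i : Fin n) : Exp A T :=
  (List.finRange n).foldr (fun j acc => .cond (S.guard i j) (.seq (S.coeff i j) (s j)) acc)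
    (.test (S.const i))

/-- `s` is a solution of the system up to the relation `R`. -/
def LeftAffineSystem.IsSolution {A : Type u} {T : Type v} {n : ℕ} (S : LeftAffineSystem A T n)
    (R : Exp A T → Exp A T → Prop) (s : Fin n → Exp A T) : Prop :=
  ∀ i, R (s i) (S.rhs s i)

/-- A system is Salomaa (up to the relation `R`) if every coefficient `e` satisfies `E(e) ≡ 0`. -/
def LeftAffineSystem.IsSalomaa {A : Type u} {T : Type v} {n : ℕ} (S : LeftAffineSystem A T n)
    (R : Exp A T → Exp A T → Prop) : Prop :=
  ∀ i j, R (.test (S.coeff i j).E) (.test .zero)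

/-- The uniqueness axiom for the relation `R`: every Salomaa system has at most one solution,
modulo `R`. -/
def UniquenessAxiom {A : Type u} {T : Type v} (R : Exp A T → Exp A T → Prop) : Prop :=
  ∀ (n : ℕ) (S : LeftAffineSystem A T n), S.IsSalomaa R →
    ∀ s s' : Fin n → Exp A T, S.IsSolution R s → S.IsSolution R s' → ∀ i, R (s i) (s' i)

/-- Provable equivalence from the GKAT axioms together with the uniqueness axiom: the smallest
congruence that subsumes Boolean equivalence, satisfies the GKAT axioms and is closed under the
uniqueness axiom. -/
def GEquivUA {A : Type u} {T : Type v} (e f : Exp A T) : Prop :=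
  ∀ R : Exp A T → Exp A T → Prop, IsGKATCongruence R → UniquenessAxiom R → R e f

/-- An intersection of congruences satisfying the GKAT axioms is again one, so that a smallest
one exists. -/
theorem isGKATCongruence_sInter {A : Type u} {T : Type v}
    (P : (Exp A T → Exp A T → Prop) → Prop) :
    IsGKATCongruence (fun e f : Exp A T => ∀ R, IsGKATCongruence R → P R → R e f) where
  equivalence :=
    ⟨fun e _ hR _ => hR.equivalence.refl e,
     fun h R hR hP => hR.equivalence.symm (h R hR hP),
     fun h h' R hR hP => hR.equivalence.trans (h R hR hP) (h' R hR hP)⟩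
  seq_congr h h' R hR hP := hR.seq_congr (h R hR hP) (h' R hR hP)
  cond_congr h h' R hR hP := hR.cond_congr (h R hR hP) (h' R hR hP)
  loop_congr h R hR hP := hR.loop_congr (h R hR hP)
  test_of_baEquiv h _ hR _ := hR.test_of_baEquiv h
  test_seq b c _ hR _ := hR.test_seq b c
  u1 b e _ hR _ := hR.u1 b e
  u2 b e f _ hR _ := hR.u2 b e f
  u3 b c e f g _ hR _ := hR.u3 b c e f g
  u4 b e f _ hR _ := hR.u4 b e f
  u5 b e f g _ hR _ := hR.u5 b e f g
  s1 e f g _ hR _ := hR.s1 e f g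
  s2 e _ hR _ := hR.s2 e
  s3 e _ hR _ := hR.s3 e
  s4 e _ hR _ := hR.s4 e
  s5 e _ hR _ := hR.s5 e
  w1 b e _ hR _ := hR.w1 b e
  w2 b c e _ hR _ := hR.w2 b c e
  w3 h h' R hR hP := hR.w3 (h R hR hP) (h' R hR hP)

theorem isGKATCongruence_gEquiv {A : Type u} {T : Type v} :
    IsGKATCongruence (GEquiv (A := A) (T := T)) := by
  have h := isGKATCongruence_sInter (A := A) (T := T) (fun _ => True)
  simp only [forall_const] at h
  exact h

theorem isGKATCongruence_gEquivUA {A : Type u} {T : Type v} :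
    IsGKATCongruence (GEquivUA (A := A) (T := T)) :=
  isGKATCongruence_sInter UniquenessAxiom

theorem uniquenessAxiom_gEquivUA {A : Type u} {T : Type v} :
    UniquenessAxiom (GEquivUA (A := A) (T := T)) :=
  fun n S hS s s' hs hs' i R hR hU =>
    hU n S (fun i j => hS i j R hR hU) s s' (fun i => hs i R hR hU) (fun i => hs' i R hR hU) i

end GKAT

/-!
Modulo the GKAT axioms, an expression is determined by its restrictions to the finitely many atoms,
and restricted to an atom it either fails, or succeeds at once, or performs one action and continues
as its syntactic derivative. Only finitely many expressions arise as iterated derivatives, so every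
expression belongs to a solution of a finite automaton, that is, of a Salomaa system whose
coefficients are single actions.

The uniqueness axiom makes two solutions of the same automaton equal. Comparing an automaton of
expressions without guarded strings with the zero solution shows that such expressions are `0`, so
that steps to dead states can be replaced by failure. After this pruning the behaviour at an atom is
a function of the language, hence the two components of pairs of expressions with the same language
solve the same automaton.
-/

namespace GKAT

universe u v w

variable {A : Type u} {T : Type v}

/-! ### Boolean expressions as sets of atoms -/

namespace BExp

theorem mem_atoms {b : BExp T} {α : Atom T} : α ∈ b.atoms ↔ b.eval α = true := Iff.rfl

@[simp]
theorem atoms_zero : (zero : BExp T).atoms = ∅ := by ext; simp [mem_atoms, eval]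

@[simp]
theorem atoms_one : (one : BExp T).atoms = Set.univ := by ext; simp [mem_atoms, eval]

@[simp]
theorem mem_atoms_prim {t : T} {α : Atom T} : α ∈ (prim t).atoms ↔ α t = true := Iff.rfl

@[simp]
theorem atoms_and (b c : BExp T) : (and b c).atoms = b.atoms ∩ c.atoms := by
  ext; simp [mem_atoms, eval]

@[simp]
theorem atoms_or (b c : BExp T) : (or b c).atoms = b.atoms ∪ c.atoms := by
  ext; simp [mem_atoms, eval]

@[simp]
theorem atoms_not (b : BExp T) : (not b).atoms = b.atomsᶜ := by ext; simp [mem_atoms, eval]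

end BExp

/-- The setoid of provable Boolean equivalence, whose quotient is the Lindenbaum algebra. -/
def baSetoid (T : Type v) : Setoid (BExp T) where
  r := BAEquiv
  iseqv := ⟨BAEquiv.refl, BAEquiv.symm, BAEquiv.trans⟩

/-- The Lindenbaum algebra: Boolean expressions modulo provable Boolean equivalence. -/
def Lindenbaum (T : Type v) : Type v := Quotient (baSetoid T)

namespace Lindenbaum

/-- The class of a Boolean expression in the Lindenbaum algebra. -/
def mk (b : BExp T) : Lindenbaum T := Quotient.mk (baSetoid T) b

theorem mk_eq_mk {b c : BExp T} : mk b = mk c ↔ BAEquiv b c := Quotient.eq (r := baSetoid T)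

instance : Max (Lindenbaum T) :=
  ⟨Quotient.map₂ BExp.or fun _ _ h _ _ h' => BAEquiv.or_congr h h'⟩

instance : Min (Lindenbaum T) :=
  ⟨Quotient.map₂ BExp.and fun _ _ h _ _ h' => BAEquiv.and_congr h h'⟩

instance : Lattice (Lindenbaum T) :=
  Lattice.mk'
    (by rintro ⟨b⟩ ⟨c⟩; exact mk_eq_mk.2 (.or_comm b c))
    (by rintro ⟨b⟩ ⟨c⟩ ⟨d⟩; exact mk_eq_mk.2 (.or_assoc b c d))
    (by rintro ⟨b⟩ ⟨c⟩; exact mk_eq_mk.2 (.and_comm b c))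
    (by rintro ⟨b⟩ ⟨c⟩ ⟨d⟩; exact mk_eq_mk.2 (.and_assoc b c d))
    (by rintro ⟨b⟩ ⟨c⟩; exact mk_eq_mk.2 (.or_absorb b c))
    (by rintro ⟨b⟩ ⟨c⟩; exact mk_eq_mk.2 (.and_absorb b c))

instance : BooleanAlgebra (Lindenbaum T) where
  le_sup_inf := by rintro ⟨b⟩ ⟨c⟩ ⟨d⟩; exact (mk_eq_mk.2 (.or_distrib b c d)).ge
  top := mk .one
  bot := mk .zero
  compl := Quotient.map BExp.not fun _ _ => BAEquiv.not_congr
  le_top := by rintro ⟨b⟩; exact inf_eq_left.1 (mk_eq_mk.2 (.and_one b))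
  bot_le := by rintro ⟨b⟩; exact sup_eq_left.1 (mk_eq_mk.2 (.or_zero b))
  inf_compl_le_bot := by rintro ⟨b⟩; exact (mk_eq_mk.2 (.and_not b)).le
  top_le_sup_compl := by rintro ⟨b⟩; exact (mk_eq_mk.2 (.or_not b)).ge

theorem mk_zero : mk (.zero : BExp T) = ⊥ := rfl

theorem mk_one : mk (.one : BExp T) = ⊤ := rfl

theorem mk_and (b c : BExp T) : mk (.and b c) = mk b ⊓ mk c := rfl

theorem mk_or (b c : BExp T) : mk (.or b c) = mk b ⊔ mk c := rfl

theorem mk_not (b : BExp T) : mk (.not b) = (mk b)ᶜ := rfl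

theorem exists_atom_forall_mem_atoms_iff {I : Order.Ideal (Lindenbaum T)} (hI : I.IsPrime) :
    ∃ α : Atom T, ∀ b : BExp T, α ∈ b.atoms ↔ mk b ∉ I := by
  classical
  have htop : (⊤ : Lindenbaum T) ∉ I := hI.toIsProper.top_notMem
  refine ⟨fun t => decide (mk (.prim t) ∉ I), fun b => ?_⟩
  induction b with
  | zero => simp [mk_zero]
  | one => simpa [mk_one] using htop
  | prim t => simp
  | and b c ihb ihc =>
    rw [BExp.atoms_and, Set.mem_inter_iff, ihb, ihc, mk_and, ← not_or, not_iff_not]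
    exact ⟨Or.rec (I.lower inf_le_left) (I.lower inf_le_right), hI.mem_or_mem⟩
  | or b c ihb ihc =>
    rw [BExp.atoms_or, Set.mem_union, ihb, ihc, mk_or, ← not_and_or, not_iff_not]
    exact Order.Ideal.sup_mem_iff.symm
  | not b ih =>
    rw [BExp.atoms_not, Set.mem_compl_iff, ih, mk_not, not_not]
    exact ⟨fun h h' => htop (by simpa using Order.Ideal.sup_mem h h'),
      hI.mem_or_compl_mem.resolve_right⟩

theorem mk_le_mk_of_atoms_subset {b c : BExp T} (h : b.atoms ⊆ c.atoms) : mk b ≤ mk c := by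
  by_contra hbc
  have hdisj : Disjoint (Order.PFilter.principal (mk b) : Set (Lindenbaum T))
      (Order.Ideal.principal (mk c)) :=
    Set.disjoint_left.2 fun _ hb hc => hbc (le_trans hb hc)
  obtain ⟨I, hI, hcI, hbI⟩ := DistribLattice.prime_ideal_of_disjoint_filter_ideal hdisj
  obtain ⟨α, hα⟩ := exists_atom_forall_mem_atoms_iff hI
  have hb : α ∈ b.atoms := (hα b).2 (Set.disjoint_left.1 hbI (le_refl (mk b)))
  exact (hα c).1 (h hb) (hcI Order.Ideal.mem_principal_self)

end Lindenbaum

theorem BAEquiv.of_atoms_eq {b c : BExp T} (h : b.atoms = c.atoms) : BAEquiv b c :=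
  Lindenbaum.mk_eq_mk.1 (le_antisymm (Lindenbaum.mk_le_mk_of_atoms_subset h.subset)
    (Lindenbaum.mk_le_mk_of_atoms_subset h.superset))

namespace BExp

theorem exists_atoms_eq_forall_mem (α : Atom T) {s : Set T} (hs : s.Finite) :
    ∃ b : BExp T, b.atoms = {β | ∀ t ∈ s, β t = α t} := by
  induction s, hs using Set.Finite.induction_on with
  | empty => exact ⟨.one, by simp⟩
  | @insert t s _ _ ih =>
    obtain ⟨b, hb⟩ := ih
    obtain ⟨c, hc⟩ : ∃ c : BExp T, c.atoms = {β | β t = α t} := by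
      cases hα : α t
      · exact ⟨.not (.prim t), by ext; simp⟩
      · exact ⟨.prim t, by ext; simp⟩
    exact ⟨.and c b, by ext; simp [hb, hc]⟩

theorem exists_atoms_eq [Finite T] (B : Set (Atom T)) : ∃ b : BExp T, b.atoms = B := by
  induction B, B.toFinite using Set.Finite.induction_on with
  | empty => exact ⟨.zero, atoms_zero⟩
  | @insert α B _ _ ih =>
    obtain ⟨b, hb⟩ := ih
    obtain ⟨c, hc⟩ := exists_atoms_eq_forall_mem α Set.finite_univ
    exact ⟨.or c b, by ext; simp [hb, hc, funext_iff]⟩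

/-- A Boolean expression that is true under exactly the atoms in `B`. -/
noncomputable def ofAtoms [Finite T] (B : Set (Atom T)) : BExp T := (exists_atoms_eq B).choose

@[simp]
theorem atoms_ofAtoms [Finite T] (B : Set (Atom T)) : (ofAtoms B).atoms = B :=
  (exists_atoms_eq B).choose_spec

end BExp

/-! ### Expressions modulo a congruence -/

variable {R : Exp A T → Exp A T → Prop}

namespace IsGKATCongruence

/-- A congruence as a setoid on expressions. -/
def toSetoid (hR : IsGKATCongruence R) : Setoid (Exp A T) := ⟨R, hR.equivalence⟩

/-- The algebra of GKAT expressions modulo a congruence. Sequential composition makes it a monoid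
with zero; guarded union is the operation `IsGKATCongruence.cond`. -/
def Quo (hR : IsGKATCongruence R) : Type (max u v) := Quotient hR.toSetoid

variable (hR : IsGKATCongruence R)

/-- The class of an expression modulo a congruence. -/
def cls (e : Exp A T) : hR.Quo := Quotient.mk hR.toSetoid e

/-- The class of a test modulo a congruence. -/
def test (b : BExp T) : hR.Quo := hR.cls (.test b)

/-- Guarded union of classes of expressions: `cond b x y` is `x +_b y`. -/
def cond (b : BExp T) : hR.Quo → hR.Quo → hR.Quo :=
  Quotient.map₂ (Exp.cond b) fun _ _ h _ _ h' => hR.cond_congr h h'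

theorem cls_eq_cls {e f : Exp A T} : hR.cls e = hR.cls f ↔ R e f := Quotient.eq (r := hR.toSetoid)

theorem cls_surjective : Function.Surjective hR.cls := Quotient.mk_surjective

instance : MonoidWithZero hR.Quo where
  mul := Quotient.map₂ Exp.seq fun _ _ h _ _ h' => hR.seq_congr h h'
  one := hR.test .one
  zero := hR.test .zero
  mul_assoc := by rintro ⟨e⟩ ⟨f⟩ ⟨g⟩; exact hR.cls_eq_cls.2 (hR.s1 e f g)
  one_mul := by rintro ⟨e⟩; exact hR.cls_eq_cls.2 (hR.s4 e)
  mul_one := by rintro ⟨e⟩; exact hR.cls_eq_cls.2 (hR.s5 e)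
  zero_mul := by rintro ⟨e⟩; exact hR.cls_eq_cls.2 (hR.s2 e)
  mul_zero := by rintro ⟨e⟩; exact hR.cls_eq_cls.2 (hR.s3 e)

theorem cls_test (b : BExp T) : hR.cls (.test b) = hR.test b := rfl

theorem cls_seq (e f : Exp A T) : hR.cls (.seq e f) = hR.cls e * hR.cls f := rfl

theorem cls_cond (b : BExp T) (e f : Exp A T) :
    hR.cls (.cond b e f) = hR.cond b (hR.cls e) (hR.cls f) := rfl

theorem cls_loop (b : BExp T) (e : Exp A T) :
    hR.cls (.loop b e) = hR.cond b (hR.cls e * hR.cls (.loop b e)) 1 :=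
  hR.cls_eq_cls.2 (hR.w1 b e)

theorem test_zero : hR.test .zero = 0 := rfl

theorem test_one : hR.test .one = 1 := rfl

theorem test_congr {b c : BExp T} (h : b.atoms = c.atoms) : hR.test b = hR.test c :=
  hR.cls_eq_cls.2 (hR.test_of_baEquiv (.of_atoms_eq h))

theorem test_mul_test (b c : BExp T) : hR.test b * hR.test c = hR.test (.and b c) :=
  hR.cls_eq_cls.2 (hR.test_seq b c)

theorem test_not_mul_test (b : BExp T) : hR.test (.not b) * hR.test b = 0 := by
  rw [test_mul_test, ← test_zero]
  exact hR.test_congr (by simp)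

theorem test_mul_test_of_subset {b c : BExp T} (h : b.atoms ⊆ c.atoms) :
    hR.test b * hR.test c = hR.test b := by
  rw [test_mul_test]
  exact hR.test_congr (by simpa using h)

theorem cond_self (b : BExp T) (x : hR.Quo) : hR.cond b x x = x := by
  rcases x with ⟨e⟩
  exact hR.cls_eq_cls.2 (hR.u1 b e)

theorem cond_not (b : BExp T) (x y : hR.Quo) : hR.cond (.not b) y x = hR.cond b x y := by
  rcases x, y with ⟨⟨e⟩, ⟨f⟩⟩
  exact (hR.cls_eq_cls.2 (hR.u2 b e f)).symm

theorem cond_cond (b c : BExp T) (x y z : hR.Quo) :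
    hR.cond c (hR.cond b x y) z = hR.cond (.and b c) x (hR.cond c y z) := by
  rcases x, y, z with ⟨⟨e⟩, ⟨f⟩, ⟨g⟩⟩
  exact hR.cls_eq_cls.2 (hR.u3 b c e f g)

theorem cond_test_mul_left (b : BExp T) (x y : hR.Quo) :
    hR.cond b (hR.test b * x) y = hR.cond b x y := by
  rcases x, y with ⟨⟨e⟩, ⟨f⟩⟩
  exact (hR.cls_eq_cls.2 (hR.u4 b e f)).symm

theorem cond_test_not_mul_right (b : BExp T) (x y : hR.Quo) :
    hR.cond b x (hR.test (.not b) * y) = hR.cond b x y := by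
  rw [← cond_not, cond_test_mul_left, cond_not]

theorem cond_zero_right (b : BExp T) (x : hR.Quo) : hR.cond b x 0 = hR.test b * x := by
  calc hR.cond b x 0 = hR.cond b (hR.test b * x) (hR.test (.not b) * (hR.test b * x)) := by
        rw [cond_test_mul_left, ← mul_assoc, test_not_mul_test, zero_mul]
    _ = hR.test b * x := by rw [cond_test_not_mul_right, cond_self]

theorem test_mul_cond_self (b : BExp T) (x y : hR.Quo) :
    hR.test b * hR.cond b x y = hR.test b * x := by
  have hbb : (BExp.and b b).atoms = b.atoms := by simp
  calc hR.test b * hR.cond b x y = hR.cond (.and b b) x (hR.test b * y) := by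
        rw [← cond_zero_right, cond_cond, cond_zero_right]
    _ = hR.cond (.and b b) x (hR.test (.not (.and b b)) * (hR.test (.and b b) * y)) := by
        rw [cond_test_not_mul_right, hR.test_congr hbb]
    _ = hR.test b * x := by
        rw [← mul_assoc, test_not_mul_test, zero_mul, cond_zero_right, hR.test_congr hbb]

theorem test_mul_cond_of_subset {a b : BExp T} (h : a.atoms ⊆ b.atoms) (x y : hR.Quo) :
    hR.test a * hR.cond b x y = hR.test a * x := by
  rw [← hR.test_mul_test_of_subset h, mul_assoc, test_mul_cond_self, ← mul_assoc]

theorem test_mul_cond_of_subset_compl {a b : BExp T} (h : a.atoms ⊆ b.atomsᶜ) (x y : hR.Quo) :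
    hR.test a * hR.cond b x y = hR.test a * y := by
  rw [← cond_not, hR.test_mul_cond_of_subset (by simpa using h)]

theorem eq_of_test_mul_eq (b : BExp T) {x y : hR.Quo} (h : hR.test b * x = hR.test b * y)
    (h' : hR.test (.not b) * x = hR.test (.not b) * y) : x = y := by
  rw [← hR.cond_self b x, ← cond_test_mul_left, ← cond_test_not_mul_right, h, h',
    cond_test_mul_left, cond_test_not_mul_right, cond_self]

theorem test_or_mul_eq {b c : BExp T} {x y : hR.Quo} (hb : hR.test b * x = hR.test b * y)
    (hc : hR.test c * x = hR.test c * y) : hR.test (.or b c) * x = hR.test (.or b c) * y := by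
  have restrict_left (z : hR.Quo) : hR.test b * (hR.test (.or b c) * z) = hR.test b * z := by
    rw [← mul_assoc, hR.test_mul_test_of_subset (by simp)]
  have restrict_right (z : hR.Quo) : hR.test (.not b) * (hR.test (.or b c) * z) =
      hR.test (.not b) * (hR.test c * z) := by
    rw [← mul_assoc, ← mul_assoc, test_mul_test, test_mul_test]
    congr 1
    exact hR.test_congr (by simp [Set.inter_union_distrib_left])
  refine hR.eq_of_test_mul_eq b ?_ ?_
  · rw [restrict_left, restrict_left, hb]
  · rw [restrict_right, restrict_right, hc]

section Atoms

variable [Finite T]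

/-- The class of the test that is true under one atom only. -/
noncomputable def atom (α : Atom T) : hR.Quo := hR.test (.ofAtoms {α})

theorem atom_mul_test_of_mem {α : Atom T} {b : BExp T} (h : α ∈ b.atoms) :
    hR.atom α * hR.test b = hR.atom α :=
  hR.test_mul_test_of_subset (by simpa using h)

theorem atom_mul_test_of_notMem {α : Atom T} {b : BExp T} (h : α ∉ b.atoms) :
    hR.atom α * hR.test b = 0 := by
  rw [atom, test_mul_test, ← test_zero]
  exact hR.test_congr (by simpa using h)

theorem atom_mul_cond_of_mem {α : Atom T} {b : BExp T} (h : α ∈ b.atoms) (x y : hR.Quo) :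
    hR.atom α * hR.cond b x y = hR.atom α * x :=
  hR.test_mul_cond_of_subset (by simpa using h) x y

theorem atom_mul_cond_of_notMem {α : Atom T} {b : BExp T} (h : α ∉ b.atoms) (x y : hR.Quo) :
    hR.atom α * hR.cond b x y = hR.atom α * y :=
  hR.test_mul_cond_of_subset_compl (by simpa using h) x y

theorem eq_of_forall_atom_mul_eq {x y : hR.Quo} (h : ∀ α, hR.atom α * x = hR.atom α * y) :
    x = y := by
  have restrict_eq (B : Set (Atom T)) : hR.test (.ofAtoms B) * x = hR.test (.ofAtoms B) * y := by
    induction B, B.toFinite using Set.Finite.induction_on with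
    | empty => rw [hR.test_congr (c := .zero) (by simp), test_zero, zero_mul, zero_mul]
    | @insert α B _ _ ih =>
      rw [hR.test_congr (c := .or (.ofAtoms {α}) (.ofAtoms B)) (by simp)]
      exact hR.test_or_mul_eq (h α) ih
  have test_univ : hR.test (.ofAtoms Set.univ) = 1 := hR.test_congr (by simp)
  simpa only [test_univ, one_mul] using restrict_eq Set.univ

theorem atom_mul_cls_loop_eq_zero {α : Atom T} {b : BExp T} {e : Exp A T} (hα : α ∈ b.atoms)
    (he : hR.atom α * hR.cls e = hR.atom α) : hR.atom α * hR.cls (.loop b e) = 0 := by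
  -- Since `e` skips at `α`, it is equal to `e +_{¬α} 1`, and `w2` replaces it by `¬α · e`.
  let c : BExp T := .not (.ofAtoms {α})
  have hc : α ∉ c.atoms := by simp [c]
  have guard_body : hR.cls e = hR.cls (.cond c e (.test .one)) := by
    rw [cls_cond]
    refine hR.eq_of_forall_atom_mul_eq fun β => ?_
    by_cases hβ : β ∈ c.atoms
    · rw [hR.atom_mul_cond_of_mem hβ]
    · obtain rfl : β = α := by simpa [c] using hβ
      rw [hR.atom_mul_cond_of_notMem hβ, he, cls_test, test_one, mul_one]
  have loop_eq : hR.cls (.loop b e) = hR.cls (.loop b (.seq (.test c) e)) := by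
    rw [hR.cls_eq_cls.2 (hR.loop_congr (hR.cls_eq_cls.1 guard_body))]
    exact hR.cls_eq_cls.2 (hR.w2 b c e)
  rw [loop_eq, cls_loop, hR.atom_mul_cond_of_mem hα, cls_seq, cls_test, ← mul_assoc, ← mul_assoc,
    hR.atom_mul_test_of_notMem hc, zero_mul, zero_mul]

end Atoms

end IsGKATCongruence

/-! ### Outcomes and derivatives -/

/-- The possible reactions of a program in state `x : X` to an atom: fail, succeed, or perform an
action and move to another state. This is the functor `2 + Σ × X` of the paper. -/
inductive Outcome (A : Type u) (X : Type w) : Type (max u w)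
  | reject : Outcome A X
  | accept : Outcome A X
  | step (p : A) (x : X) : Outcome A X

namespace Outcome

variable {X Y Z : Type*}

/-- The functorial action of `Outcome A` on a map of states. -/
def map (k : X → Y) : Outcome A X → Outcome A Y
  | reject => reject
  | accept => accept
  | step p x => step p (k x)

/-- The reaction of a sequential composition. If the first program succeeds, the second one reacts
to the same atom; otherwise the remaining state `x` of the first is turned into a state `k x` of the
composition. -/
def andThen (o : Outcome A X) (k : X → Y) (o' : Outcome A Y) : Outcome A Y :=
  match o with
  | reject => reject
  | accept => o'
  | step p x => step p (k x)

theorem map_eq_step_iff {k : X → Y} {o : Outcome A X} {p : A} {y : Y} :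
    o.map k = step p y ↔ ∃ x, o = step p x ∧ k x = y := by
  cases o <;> simp [map, and_assoc]

theorem andThen_eq_step_iff {k : X → Y} {o : Outcome A X} {o' : Outcome A Y} {p : A} {y : Y} :
    o.andThen k o' = step p y ↔ (∃ x, o = step p x ∧ k x = y) ∨ o = accept ∧ o' = step p y := by
  cases o <;> simp [andThen, and_assoc]

theorem map_andThen (k : X → Y) (l : Y → Z) (o : Outcome A X) (o' : Outcome A Y) :
    (o.andThen k o').map l = o.andThen (l ∘ k) (o'.map l) := by
  cases o <;> rfl

end Outcome

/-- A deterministic automaton on guarded strings with states `X`. -/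
abbrev Automaton (A : Type u) (T : Type v) (X : Type w) : Type (max u v w) :=
  X → Atom T → Outcome A X

/-- A set of states that is not left by any transition. -/
def Automaton.IsClosed {X : Type*} (δ : Automaton A T X) (S : Set X) : Prop :=
  ∀ x ∈ S, ∀ α p y, δ x α = .step p y → y ∈ S

namespace Exp

/-- The syntactic derivative. A loop whose body succeeds at once fails, because it diverges. -/
def deriv : Automaton A T (Exp A T)
  | act p, _ => .step p (test .one)
  | test b, α => if b.eval α then .accept else .reject
  | seq e f, α => (e.deriv α).andThen (seq · f) (f.deriv α)
  | cond b e f, α => if b.eval α then e.deriv α else f.deriv α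
  | loop b e, α =>
    if b.eval α then (e.deriv α).andThen (seq · (loop b e)) .reject else .accept

/-- A finite set of expressions that contains all iterated derivatives of the given one. -/
def reach : Exp A T → Set (Exp A T)
  | act p => {act p, test .one}
  | test b => {test b}
  | seq e f => (seq · f) '' e.reach ∪ f.reach
  | cond b e f => insert (cond b e f) (e.reach ∪ f.reach)
  | loop b e => insert (loop b e) ((seq · (loop b e)) '' e.reach)

theorem finite_reach (e : Exp A T) : e.reach.Finite := by
  induction e with
  | act p => exact Set.toFinite {act p, test .one}
  | test b => exact Set.finite_singleton _
  | seq e f ihe ihf => exact (ihe.image _).union ihf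
  | cond b e f ihe ihf => exact (ihe.union ihf).insert _
  | loop b e ih => exact (ih.image _).insert _

theorem self_mem_reach (e : Exp A T) : e ∈ e.reach := by
  cases e with
  | seq e f => exact .inl ⟨e, self_mem_reach e, rfl⟩
  | _ => simp [reach]

theorem exists_of_deriv_loop_eq_step {b : BExp T} {e g : Exp A T} {α : Atom T} {p : A}
    (h : (loop b e).deriv α = .step p g) :
    ∃ e', e.deriv α = .step p e' ∧ seq e' (loop b e) = g := by
  rw [deriv] at h
  split_ifs at h
  exact (Outcome.andThen_eq_step_iff.1 h).resolve_right (by simp)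

theorem isClosed_reach (e : Exp A T) : deriv.IsClosed e.reach := by
  induction e with
  | act p => rintro _ (rfl | rfl) α q g h <;> simp_all [deriv, reach, BExp.eval]
  | test b =>
    rintro _ rfl α p g h
    grind [deriv]
  | seq e f ihe ihf =>
    rintro _ (⟨e', he', rfl⟩ | hf') α p g h
    · obtain ⟨e'', he'', rfl⟩ | ⟨-, hf⟩ := Outcome.andThen_eq_step_iff.1 h
      · exact .inl ⟨e'', ihe e' he' α p e'' he'', rfl⟩
      · exact .inr (ihf f f.self_mem_reach α p g hf)
    · exact .inr (ihf _ hf' α p g h)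
  | cond b e f ihe ihf =>
    rintro _ (rfl | he' | hf') α p g h
    · rw [deriv] at h
      split_ifs at h
      · exact .inr (.inl (ihe e e.self_mem_reach α p g h))
      · exact .inr (.inr (ihf f f.self_mem_reach α p g h))
    · exact .inr (.inl (ihe _ he' α p g h))
    · exact .inr (.inr (ihf _ hf' α p g h))
  | loop b e ih =>
    have step_loop (α p g) (h : (loop b e).deriv α = .step p g) :
        g ∈ (seq · (loop b e)) '' e.reach := by
      obtain ⟨e', he', rfl⟩ := exists_of_deriv_loop_eq_step h
      exact ⟨e', ih e e.self_mem_reach α p e' he', rfl⟩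
    rintro _ (rfl | ⟨e', he', rfl⟩) α p g h
    · exact .inr (step_loop α p g h)
    · obtain ⟨e'', he'', rfl⟩ | ⟨-, h'⟩ := Outcome.andThen_eq_step_iff.1 h
      · exact .inr ⟨e'', ih e' he' α p e'' he'', rfl⟩
      · exact .inr (step_loop α p g h')

end Exp

namespace IsGKATCongruence

variable {X Y : Type*} (hR : IsGKATCongruence R)

/-- The class that performs an outcome and continues from its state `x` as `s x`. -/
def ofOutcome (s : X → hR.Quo) : Outcome A X → hR.Quo
  | .reject => 0
  | .accept => 1
  | .step p x => hR.cls (.act p) * s x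

theorem ofOutcome_map (s : Y → hR.Quo) (k : X → Y) (o : Outcome A X) :
    hR.ofOutcome s (o.map k) = hR.ofOutcome (s ∘ k) o := by
  cases o <;> rfl

variable [Finite T]

theorem atom_mul_mul_eq_ofOutcome_andThen {α : Atom T} {x y : hR.Quo} {o : Outcome A X}
    {o' : Outcome A Y} {s : X → hR.Quo} {s' : Y → hR.Quo} {k : X → Y}
    (hx : hR.atom α * x = hR.atom α * hR.ofOutcome s o)
    (hy : o = .accept → hR.atom α * y = hR.atom α * hR.ofOutcome s' o')
    (hk : ∀ z, s z * y = s' (k z)) :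
    hR.atom α * (x * y) = hR.atom α * hR.ofOutcome s' (o.andThen k o') := by
  rw [← mul_assoc, hx]
  cases o with
  | reject => simp [ofOutcome, Outcome.andThen]
  | accept => simpa [ofOutcome, Outcome.andThen] using hy rfl
  | step p z => simp only [ofOutcome, Outcome.andThen, mul_assoc, hk]

theorem atom_mul_cls_eq_ofOutcome_deriv (α : Atom T) (e : Exp A T) :
    hR.atom α * hR.cls e = hR.atom α * hR.ofOutcome hR.cls (e.deriv α) := by
  induction e with
  | act p => rw [Exp.deriv, ofOutcome, cls_test, test_one, mul_one]
  | test b =>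
    rw [cls_test, Exp.deriv]
    split_ifs with h
    · rw [hR.atom_mul_test_of_mem h, ofOutcome, mul_one]
    · rw [hR.atom_mul_test_of_notMem h, ofOutcome, mul_zero]
  | seq e f ihe ihf => exact hR.atom_mul_mul_eq_ofOutcome_andThen ihe (fun _ => ihf) fun _ => rfl
  | cond b e f ihe ihf =>
    rw [cls_cond, Exp.deriv]
    split_ifs with h
    · rw [hR.atom_mul_cond_of_mem h, ihe]
    · rw [hR.atom_mul_cond_of_notMem h, ihf]
  | loop b e ih =>
    rw [Exp.deriv]
    split_ifs with h
    · rw [cls_loop, hR.atom_mul_cond_of_mem h]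
      refine hR.atom_mul_mul_eq_ofOutcome_andThen ih (fun he => ?_) fun _ => rfl
      rw [ofOutcome, mul_zero]
      exact hR.atom_mul_cls_loop_eq_zero h (by rw [ih, he, ofOutcome, mul_one])
    · rw [cls_loop, hR.atom_mul_cond_of_notMem h, ofOutcome]

end IsGKATCongruence

/-! ### Derivatives and the language model -/

theorem GString.last_append {x y : GString A T} (h : x.last = y.first) :
    (⟨x.first, x.steps ++ y.steps⟩ : GString A T).last = y.last := by
  simp only [GString.last, List.foldl_append] at h ⊢
  rw [h]

namespace Lang

theorem mk_mem_ofAtoms {B : Set (Atom T)} {α : Atom T} {s : List (A × Atom T)} :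
    (⟨α, s⟩ : GString A T) ∈ ofAtoms B ↔ α ∈ B ∧ s = [] := by
  constructor
  · rintro ⟨β, hβ, ⟨⟩⟩
    exact ⟨hβ, rfl⟩
  · rintro ⟨h, rfl⟩
    exact ⟨α, h, rfl⟩

theorem mem_ofAtoms_fusion {B : Set (Atom T)} {L : Lang A T} {w : GString A T} :
    w ∈ (ofAtoms B).fusion L ↔ w.first ∈ B ∧ w ∈ L := by
  constructor
  · rintro ⟨_, ⟨β, hβ, rfl⟩, y, hy, rfl : β = y.first, rfl⟩
    exact ⟨hβ, hy⟩
  · rintro ⟨h, h'⟩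
    exact ⟨.ofAtom w.first, ⟨_, h, rfl⟩, w, h', rfl, rfl⟩

theorem ofAtoms_univ_fusion (L : Lang A T) : (ofAtoms Set.univ).fusion L = L := by
  ext w
  simp [mem_ofAtoms_fusion]

theorem fusion_ofAtoms_univ (L : Lang A T) : L.fusion (ofAtoms Set.univ) = L := by
  ext w
  constructor
  · rintro ⟨x, hx, _, ⟨β, -, rfl⟩, -, rfl⟩
    simpa [GString.ofAtom] using hx
  · exact fun hw => ⟨w, hw, .ofAtom w.last, ⟨_, trivial, rfl⟩, rfl, by simp [GString.ofAtom]⟩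

theorem fusion_assoc (L K M : Lang A T) : (L.fusion K).fusion M = L.fusion (K.fusion M) := by
  ext w
  constructor
  · rintro ⟨_, ⟨x, hx, y, hy, hxy, rfl⟩, z, hz, hyz, rfl⟩
    rw [GString.last_append hxy] at hyz
    exact ⟨x, hx, _, ⟨y, hy, z, hz, hyz, rfl⟩, hxy, by simp⟩
  · rintro ⟨x, hx, _, ⟨y, hy, z, hz, hyz, rfl⟩, hxy, rfl⟩
    refine ⟨_, ⟨x, hx, y, hy, hxy, rfl⟩, z, hz, ?_, by simp⟩
    exact (GString.last_append (y := y) hxy).trans hyz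

theorem fusion_iUnion {ι : Sort*} (L : Lang A T) (K : ι → Lang A T) :
    L.fusion (⋃ i, K i) = ⋃ i, L.fusion (K i) := by
  ext w
  simp only [fusion, Set.mem_iUnion, Set.mem_ofPred_eq]
  tauto

theorem power_succ' (L : Lang A T) (n : ℕ) : L.power (n + 1) = L.fusion (L.power n) := by
  induction n with
  | zero => exact (ofAtoms_univ_fusion L).trans (fusion_ofAtoms_univ L).symm
  | succ n ih =>
    calc (L.power (n + 1)).fusion L = L.fusion ((L.power n).fusion L) := by rw [ih, fusion_assoc]
      _ = L.fusion (L.power (n + 1)) := rfl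

theorem loop_eq (B : Set (Atom T)) (L : Lang A T) :
    loop B L = ofAtoms Bᶜ ∪ (ofAtoms B).fusion (L.fusion (loop B L)) := by
  rw [← fusion_assoc]
  simp only [loop, fusion_iUnion]
  simp only [← fusion_assoc, ← power_succ']
  rw [← Set.union_iUnion_nat_succ, power, ofAtoms_univ_fusion]

theorem loop_subset {B : Set (Atom T)} {L K : Lang A T} (hB : ofAtoms Bᶜ ⊆ K)
    (hL : (ofAtoms B).fusion (L.fusion K) ⊆ K) : loop B L ⊆ K := by
  refine Set.iUnion_subset fun n => ?_
  induction n with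
  | zero => rwa [power, ofAtoms_univ_fusion]
  | succ n ih =>
    rw [power_succ', fusion_assoc, fusion_assoc]
    refine subset_trans ?_ hL
    rintro _ ⟨x, hx, _, ⟨y, hy, z, hz, hyz, rfl⟩, hxy, rfl⟩
    exact ⟨x, hx, _, ⟨y, hy, z, ih hz, hyz, rfl⟩, hxy, rfl⟩

theorem mk_mem_loop_iff_of_mem {B : Set (Atom T)} {L : Lang A T} {α : Atom T} (hα : α ∈ B)
    {s : List (A × Atom T)} :
    (⟨α, s⟩ : GString A T) ∈ loop B L ↔ ⟨α, s⟩ ∈ L.fusion (loop B L) := by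
  rw [loop_eq, Set.mem_union, mk_mem_ofAtoms, mem_ofAtoms_fusion, ← loop_eq]
  simp [hα]

theorem mk_mem_loop_iff_of_notMem {B : Set (Atom T)} {L : Lang A T} {α : Atom T} (hα : α ∉ B)
    {s : List (A × Atom T)} : (⟨α, s⟩ : GString A T) ∈ loop B L ↔ s = [] := by
  rw [loop_eq, Set.mem_union, mk_mem_ofAtoms, mem_ofAtoms_fusion]
  simp [hα]

theorem mk_notMem_loop {B : Set (Atom T)} {L : Lang A T} {α : Atom T} (hα : α ∈ B)
    (hL : ∀ s, (⟨α, s⟩ : GString A T) ∈ L → s = []) (s : List (A × Atom T)) :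
    (⟨α, s⟩ : GString A T) ∉ loop B L := by
  suffices loop B L ⊆ {w | w.first ≠ α} from fun h => this h rfl
  refine loop_subset ?_ ?_
  · rintro _ ⟨β, hβ, rfl⟩ rfl
    exact hβ hα
  · rintro _ hw rfl
    obtain ⟨⟨β, r⟩, hx, y, hy, hxy, rfl⟩ := (mem_ofAtoms_fusion.1 hw).2
    obtain rfl : r = [] := hL r hx
    exact hy hxy.symm

end Lang

namespace Outcome

/-- The guarded strings described by an outcome at an atom whose states are languages, with the
first atom left out. -/
def tails : Outcome A (Lang A T) → Set (List (A × Atom T))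
  | reject => ∅
  | accept => {[]}
  | step p L => {s | ∃ β r, s = (p, β) :: r ∧ ⟨β, r⟩ ∈ L}

end Outcome

theorem Lang.mk_mem_fusion_iff {L K : Lang A T} {α : Atom T} {o o' : Outcome A (Lang A T)}
    (hL : ∀ s, ⟨α, s⟩ ∈ L ↔ s ∈ o.tails) (hK : o = .accept → ∀ s, ⟨α, s⟩ ∈ K ↔ s ∈ o'.tails)
    (s : List (A × Atom T)) : ⟨α, s⟩ ∈ L.fusion K ↔ s ∈ (o.andThen (·.fusion K) o').tails := by
  cases o with
  | reject =>
    refine iff_of_false ?_ id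
    rintro ⟨⟨_, r⟩, hx, _, _, _, ⟨⟩⟩
    exact (hL r).1 hx
  | accept =>
    refine Iff.trans ⟨?_, fun hs => ⟨.ofAtom α, (hL []).2 rfl, ⟨α, s⟩, hs, rfl, rfl⟩⟩ (hK rfl s)
    rintro ⟨⟨_, r⟩, hx, y, hy, hxy, ⟨⟩⟩
    obtain rfl : r = [] := (hL r).1 hx
    obtain rfl : _ = y.first := hxy
    exact hy
  | step p M =>
    constructor
    · rintro ⟨⟨_, r⟩, hx, y, hy, hxy, ⟨⟩⟩
      obtain ⟨β, r', rfl, hr'⟩ := (hL r).1 hx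
      exact ⟨β, _, rfl, ⟨β, r'⟩, hr', y, hy, hxy, rfl⟩
    · rintro ⟨_, _, rfl, x, hx, y, hy, hxy, ⟨⟩⟩
      exact ⟨⟨α, (p, x.first) :: x.steps⟩, (hL _).2 ⟨_, _, rfl, hx⟩, y, hy, hxy, rfl⟩

theorem Exp.mk_mem_sem_iff (e : Exp A T) (α : Atom T) (s : List (A × Atom T)) :
    ⟨α, s⟩ ∈ e.sem ↔ s ∈ ((e.deriv α).map sem).tails := by
  induction e generalizing s with
  | act p =>
    simp [sem, deriv, Outcome.map, Outcome.tails, Lang.mk_mem_ofAtoms]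
  | test b =>
    rw [sem, deriv, Lang.mk_mem_ofAtoms]
    split_ifs with h <;> simp [BExp.mem_atoms, Outcome.map, Outcome.tails, h]
  | seq e f ihe ihf =>
    rw [sem, deriv, Outcome.map_andThen, Lang.mk_mem_fusion_iff ihe fun _ => ihf]
    cases e.deriv α <;> rfl
  | cond b e f ihe ihf =>
    rw [sem, deriv, Lang.cond, Set.mem_union, Lang.mem_ofAtoms_fusion, Lang.mem_ofAtoms_fusion,
      ihe, ihf]
    split_ifs with h <;> simp [BExp.mem_atoms, h]
  | loop b e ih =>
    rw [sem, deriv]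
    split_ifs with h
    · have diverges (he : (e.deriv α).map sem = .accept) (s : List (A × Atom T)) :
          ⟨α, s⟩ ∈ Lang.loop b.atoms e.sem ↔ s ∈ Outcome.reject.tails :=
        iff_of_false (Lang.mk_notMem_loop h (fun s hs => by rwa [ih, he] at hs) s) id
      rw [Lang.mk_mem_loop_iff_of_mem h, Outcome.map_andThen, Lang.mk_mem_fusion_iff ih diverges]
      cases e.deriv α <;> rfl
    · exact Lang.mk_mem_loop_iff_of_notMem h

/-! ### Automata and the uniqueness axiom -/

section Uniqueness

variable [Finite T] {X : Type*}

namespace IsGKATCongruence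

variable (hR : IsGKATCongruence R)

theorem atom_mul_cls_foldr_cond {ι : Type*} {α : Atom T} {x : hR.Quo} {g : ι → BExp T}
    {f : ι → Exp A T} {d : Exp A T} (l : List ι)
    (hg : ∀ j ∈ l, α ∈ (g j).atoms → hR.atom α * x = hR.atom α * hR.cls (f j))
    (hd : (∀ j ∈ l, α ∉ (g j).atoms) → hR.atom α * x = hR.atom α * hR.cls d) :
    hR.atom α * x = hR.atom α * hR.cls (l.foldr (fun j e => .cond (g j) (f j) e) d) := by
  induction l with
  | nil => exact hd (by simp)
  | cons j l ih =>
    rw [List.foldr_cons, cls_cond]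
    by_cases hj : α ∈ (g j).atoms
    · rw [hR.atom_mul_cond_of_mem hj]
      exact hg j List.mem_cons_self hj
    · rw [hR.atom_mul_cond_of_notMem hj]
      exact ih (fun k hk => hg k (List.mem_cons_of_mem j hk))
        fun h => hd (List.forall_mem_cons.2 ⟨hj, h⟩)

theorem isSolution_of_forall_atom {n : ℕ} {S : LeftAffineSystem A T n} {s : Fin n → Exp A T}
    (hguard : ∀ i j, ∀ α ∈ (S.guard i j).atoms,
      hR.atom α * hR.cls (s i) = hR.atom α * (hR.cls (S.coeff i j) * hR.cls (s j)))
    (hconst : ∀ i α, (∀ j, α ∉ (S.guard i j).atoms) →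
      hR.atom α * hR.cls (s i) = hR.atom α * hR.test (S.const i)) :
    S.IsSolution R s := fun i =>
  hR.cls_eq_cls.1 <| hR.eq_of_forall_atom_mul_eq fun α =>
    hR.atom_mul_cls_foldr_cond _ (fun j _ hα => hguard i j α hα)
      fun hα => hconst i α fun j => hα j (List.mem_finRange j)

/-- `s` assigns to the states in `S` classes of expressions whose behaviour at each atom is the one
prescribed by the automaton `δ`. -/
def IsSolutionOn (δ : Automaton A T X) (S : Set X) (s : X → hR.Quo) : Prop :=
  ∀ x ∈ S, ∀ α, hR.atom α * s x = hR.atom α * hR.ofOutcome s (δ x α)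

end IsGKATCongruence

/-- The expression that performs the action of an outcome, if there is one. -/
def Outcome.label : Outcome A X → Exp A T
  | .step p _ => .act p
  | _ => .test .zero

namespace Automaton

variable (δ : Automaton A T X) {S : Set X} {n : ℕ} (φ : Fin n ≃ Atom T × S)

/-- The system of equations of an automaton with states `S`. There is one variable for each pair of
an atom and a state, which stands for the state and does not depend on the atom: this allows the
coefficient of the pair `(α, y)` to be the single action performed at `α`. -/
noncomputable def system : LeftAffineSystem A T n where
  coeff k l := (δ (φ k).2 (φ l).1).label
  guard k l := .ofAtoms {α | α = (φ l).1 ∧ ∃ p, δ (φ k).2 α = .step p (φ l).2}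
  const k := .ofAtoms {α | δ (φ k).2 α = .accept}
  guard_disjoint k l m hlm := by
    refine .of_atoms_eq ?_
    rw [BExp.atoms_and, BExp.atoms_ofAtoms, BExp.atoms_ofAtoms, BExp.atoms_zero,
      ← Set.disjoint_iff_inter_eq_empty, Set.disjoint_left]
    rintro α ⟨hl, p, hp⟩ ⟨hm, q, hq⟩
    obtain ⟨-, hlm'⟩ := Outcome.step.inj (hp.symm.trans hq)
    exact hlm (φ.injective (Prod.ext (hl.symm.trans hm) (Subtype.ext hlm')))
  const_disjoint k l := by
    refine .of_atoms_eq ?_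
    rw [BExp.atoms_and, BExp.atoms_ofAtoms, BExp.atoms_ofAtoms, BExp.atoms_zero,
      ← Set.disjoint_iff_inter_eq_empty, Set.disjoint_left]
    rintro α ⟨-, p, hp⟩ hα
    cases hp.symm.trans hα

theorem isSalomaa_system (hR : IsGKATCongruence R) : (δ.system φ).IsSalomaa R := fun k l => by
  have E_coeff : ((δ.system φ).coeff k l).E = .zero := by
    simp only [system]
    cases δ (φ k).2 (φ l).1 <;> rfl
  rw [E_coeff]
  exact hR.equivalence.refl _

variable {δ}

theorem isSolution_system (hR : IsGKATCongruence R) (hδ : δ.IsClosed S) {s : X → Exp A T}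
    (hs : hR.IsSolutionOn δ S (hR.cls ∘ s)) :
    (δ.system φ).IsSolution R fun k => s (φ k).2 := by
  refine hR.isSolution_of_forall_atom (fun k l α hα => ?_) fun k α hα => ?_
  · rw [system, BExp.atoms_ofAtoms] at hα
    obtain ⟨rfl, p, hp⟩ := hα
    simpa [system, hp, Outcome.label, IsGKATCongruence.ofOutcome]
      using hs _ (φ k).2.2 (φ l).1
  · refine (hs _ (φ k).2.2 α).trans ?_
    cases hk : δ (φ k).2 α with
    | reject =>
      rw [hR.atom_mul_test_of_notMem (by simp [system, hk]),
        IsGKATCongruence.ofOutcome, mul_zero]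
    | accept =>
      rw [hR.atom_mul_test_of_mem (by simp [system, hk]),
        IsGKATCongruence.ofOutcome, mul_one]
    | step p y =>
      have hy : y ∈ S := hδ _ (φ k).2.2 α p y hk
      exact absurd (by simp [system, hk]) (hα (φ.symm (α, ⟨y, hy⟩)))

end Automaton

theorem UniquenessAxiom.eqOn_of_isSolutionOn (hU : UniquenessAxiom R) {hR : IsGKATCongruence R}
    {δ : Automaton A T X} {S : Set X} (hS : S.Finite) (hδ : δ.IsClosed S) {s s' : X → hR.Quo}
    (hs : hR.IsSolutionOn δ S s) (hs' : hR.IsSolutionOn δ S s') : S.EqOn s s' := by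
  have := hS.to_subtype
  obtain ⟨n, ⟨φ⟩⟩ := Finite.exists_equiv_fin (Atom T × S)
  obtain ⟨t, rfl⟩ := hR.cls_surjective.comp_left s
  obtain ⟨t', rfl⟩ := hR.cls_surjective.comp_left s'
  intro x hx
  have := hU n (δ.system φ.symm) (δ.isSalomaa_system φ.symm hR) _ _
    (Automaton.isSolution_system φ.symm hR hδ hs) (Automaton.isSolution_system φ.symm hR hδ hs')
    (φ (fun _ => true, ⟨x, hx⟩))
  simpa using hR.cls_eq_cls.2 this

end Uniqueness

/-! ### Dead states and completeness -/

namespace Outcome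

variable {X Y Z : Type*}

theorem nil_mem_tails_iff {o : Outcome A (Lang A T)} : [] ∈ o.tails ↔ o = accept := by
  cases o <;> simp [tails]

theorem cons_mem_tails_iff {o : Outcome A (Lang A T)} {p : A} {β : Atom T}
    {s : List (A × Atom T)} : (p, β) :: s ∈ o.tails ↔ ∃ L, o = step p L ∧ ⟨β, s⟩ ∈ L := by
  cases o with
  | step q L => grind [tails]
  | _ => simp [tails]

theorem injOn_tails : Set.InjOn tails {o : Outcome A (Lang A T) | ∀ p, o ≠ .step p ∅} := by
  intro o ho o' ho' h
  cases o with
  | accept => exact (nil_mem_tails_iff.1 (h ▸ nil_mem_tails_iff.2 rfl)).symm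
  | step p L =>
    obtain ⟨w, hw⟩ := Set.nonempty_iff_ne_empty.2 fun hL => ho p (hL ▸ rfl)
    have mem_iff (w) : w ∈ L ↔ ∃ M, o' = step p M ∧ w ∈ M := by
      rw [← cons_mem_tails_iff, ← h, cons_mem_tails_iff]
      simp
    obtain ⟨M, rfl, -⟩ := (mem_iff w).1 hw
    have : L = M := Set.ext fun w => by simpa using mem_iff w
    rw [this]
  | reject =>
    cases o' with
    | reject => rfl
    | accept => exact absurd (h ▸ nil_mem_tails_iff.2 rfl) (Set.notMem_empty _)
    | step p L =>
      obtain ⟨w, hw⟩ := Set.nonempty_iff_ne_empty.2 fun hL => ho' p (hL ▸ rfl)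
      exact absurd (h ▸ cons_mem_tails_iff.2 ⟨L, rfl, hw⟩) (Set.notMem_empty _)

open Classical in
/-- Replace the steps to states outside `S` by failure. -/
noncomputable def restrict (S : Set X) : Outcome A X → Outcome A X
  | reject => reject
  | accept => accept
  | step p x => if x ∈ S then step p x else reject

theorem restrict_eq_step_iff {S : Set X} {o : Outcome A X} {p : A} {x : X} :
    o.restrict S = step p x ↔ o = step p x ∧ x ∈ S := by
  cases o with
  | step q y => grind [restrict]
  | _ => simp [restrict]

/-- The outcome that pairs up the states of two outcomes of the same shape. -/
def zip : Outcome A X → Outcome A Y → Outcome A (X × Y)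
  | accept, accept => accept
  | step p x, step _ y => step p (x, y)
  | _, _ => reject

variable {k : X → Z} {l : Y → Z} {o : Outcome A X} {o' : Outcome A Y}

theorem map_fst_zip (h : o.map k = o'.map l) : (o.zip o').map Prod.fst = o := by
  cases o <;> cases o' <;> first | rfl | cases h

theorem map_snd_zip (h : o.map k = o'.map l) : (o.zip o').map Prod.snd = o' := by
  cases o <;> cases o' <;> simp_all [map, zip]

end Outcome

namespace Exp

theorem sem_eq_empty_of_deriv_eq_step {e e' : Exp A T} {α : Atom T} {p : A} (he : e.sem = ∅)
    (h : e.deriv α = .step p e') : e'.sem = ∅ := by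
  refine Set.eq_empty_of_forall_notMem fun w hw => ?_
  have : ⟨α, (p, w.first) :: w.steps⟩ ∈ e.sem := by
    rw [mk_mem_sem_iff, h]
    exact ⟨w.first, w.steps, rfl, hw⟩
  simp [he] at this

theorem deriv_ne_accept_of_sem_eq_empty {e : Exp A T} (he : e.sem = ∅) (α : Atom T) :
    e.deriv α ≠ .accept := fun h => by
  have : ⟨α, []⟩ ∈ e.sem := by
    rw [mk_mem_sem_iff, h]
    rfl
  simp [he] at this

/-- The derivative in which steps to expressions without guarded strings are replaced by failure. -/
noncomputable def liveDeriv : Automaton A T (Exp A T) := fun e α =>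
  (e.deriv α).restrict {f | f.sem.Nonempty}

theorem tails_map_sem_liveDeriv (e : Exp A T) (α : Atom T) :
    ((e.liveDeriv α).map sem).tails = ((e.deriv α).map sem).tails := by
  rw [liveDeriv]
  cases e.deriv α with
  | step p f =>
    by_cases hf : f.sem.Nonempty
    · simp [Outcome.restrict, hf]
    · simp [Outcome.restrict, Outcome.map, Outcome.tails, Set.not_nonempty_iff_eq_empty.1 hf]
  | _ => rfl

theorem map_sem_liveDeriv_congr {e f : Exp A T} (h : e.sem = f.sem) (α : Atom T) :
    (e.liveDeriv α).map sem = (f.liveDeriv α).map sem := by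
  have live (e : Exp A T) (p : A) : (e.liveDeriv α).map sem ≠ .step p ∅ := by
    rw [Ne, Outcome.map_eq_step_iff]
    rintro ⟨g, hg, hg'⟩
    exact (Outcome.restrict_eq_step_iff.1 hg).2.ne_empty hg'
  refine Outcome.injOn_tails (live e) (live f) ?_
  rw [tails_map_sem_liveDeriv, tails_map_sem_liveDeriv]
  ext s
  rw [← mk_mem_sem_iff, ← mk_mem_sem_iff, h]

end Exp

namespace UniquenessAxiom

variable [Finite T] (hU : UniquenessAxiom R) (hR : IsGKATCongruence R)

include hU hR

theorem cls_eq_zero {e : Exp A T} (he : e.sem = ∅) : hR.cls e = 0 := by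
  have closed : Exp.deriv.IsClosed {f ∈ e.reach | f.sem = ∅} := fun f hf α p g h =>
    ⟨e.isClosed_reach f hf.1 α p g h, Exp.sem_eq_empty_of_deriv_eq_step hf.2 h⟩
  have zero_solution : hR.IsSolutionOn Exp.deriv {f ∈ e.reach | f.sem = ∅} 0 := by
    intro f hf α
    cases h : f.deriv α with
    | reject => rfl
    | accept => exact absurd h (Exp.deriv_ne_accept_of_sem_eq_empty hf.2 α)
    | step p g => simp [IsGKATCongruence.ofOutcome]
  exact hU.eqOn_of_isSolutionOn (e.finite_reach.subset (Set.sep_subset _ _)) closed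
    (fun f _ α => hR.atom_mul_cls_eq_ofOutcome_deriv α f) zero_solution ⟨e.self_mem_reach, he⟩

theorem atom_mul_cls_eq_ofOutcome_liveDeriv (α : Atom T) (e : Exp A T) :
    hR.atom α * hR.cls e = hR.atom α * hR.ofOutcome hR.cls (e.liveDeriv α) := by
  rw [hR.atom_mul_cls_eq_ofOutcome_deriv, Exp.liveDeriv]
  cases e.deriv α with
  | step p f =>
    by_cases hf : f.sem.Nonempty
    · simp [Outcome.restrict, hf]
    · simp [Outcome.restrict, hf, IsGKATCongruence.ofOutcome,
        hU.cls_eq_zero hR (Set.not_nonempty_iff_eq_empty.1 hf)]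
  | _ => rfl

theorem of_sem_eq {e₁ e₂ : Exp A T} (h : e₁.sem = e₂.sem) : R e₁ e₂ := by
  let S : Set (Exp A T × Exp A T) := {m ∈ e₁.reach ×ˢ e₂.reach | m.1.sem = m.2.sem}
  let δ : Automaton A T (Exp A T × Exp A T) := fun m α => (m.1.liveDeriv α).zip (m.2.liveDeriv α)
  have map_fst (m) (hm : m ∈ S) (α) : (δ m α).map Prod.fst = m.1.liveDeriv α :=
    Outcome.map_fst_zip (Exp.map_sem_liveDeriv_congr hm.2 α)
  have map_snd (m) (hm : m ∈ S) (α) : (δ m α).map Prod.snd = m.2.liveDeriv α :=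
    Outcome.map_snd_zip (Exp.map_sem_liveDeriv_congr hm.2 α)
  have closed : δ.IsClosed S := by
    intro m hm α p m' h
    have h₁ : m.1.liveDeriv α = .step p m'.1 := by rw [← map_fst m hm, h, Outcome.map]
    have h₂ : m.2.liveDeriv α = .step p m'.2 := by rw [← map_snd m hm, h, Outcome.map]
    refine ⟨⟨?_, ?_⟩, ?_⟩
    · exact e₁.isClosed_reach m.1 hm.1.1 α p m'.1 (Outcome.restrict_eq_step_iff.1 h₁).1
    · exact e₂.isClosed_reach m.2 hm.1.2 α p m'.2 (Outcome.restrict_eq_step_iff.1 h₂).1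
    · simpa [h₁, h₂, Outcome.map] using Exp.map_sem_liveDeriv_congr hm.2 α
  have fst_solution : hR.IsSolutionOn δ S (hR.cls ∘ Prod.fst) := fun m hm α => by
    rw [← hR.ofOutcome_map, map_fst m hm]
    exact hU.atom_mul_cls_eq_ofOutcome_liveDeriv hR α m.1
  have snd_solution : hR.IsSolutionOn δ S (hR.cls ∘ Prod.snd) := fun m hm α => by
    rw [← hR.ofOutcome_map, map_snd m hm]
    exact hU.atom_mul_cls_eq_ofOutcome_liveDeriv hR α m.2
  have finite : S.Finite := (e₁.finite_reach.prod e₂.finite_reach).subset (Set.sep_subset _ _)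
  have mem : (e₁, e₂) ∈ S := ⟨⟨e₁.self_mem_reach, e₂.self_mem_reach⟩, h⟩
  exact hR.cls_eq_cls.1
    (hU.eqOn_of_isSolutionOn finite closed fst_solution snd_solution mem)

end UniquenessAxiom

end GKAT

/-- Completeness of the GKAT axioms with the uniqueness axiom for the language model. The first
part takes the uniqueness axiom as a further rule of the axiomatization; the second part takes it
as an assumption on the congruence generated by the GKAT axioms alone. -/
theorem mainTheorem1 {A T : Type*} [Finite T] :
    (∀ e₁ e₂ : GKAT.Exp A T, e₁.sem = e₂.sem → GKAT.GEquivUA e₁ e₂) ∧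
    (GKAT.UniquenessAxiom (GKAT.GEquiv (A := A) (T := T)) →
      ∀ e₁ e₂ : GKAT.Exp A T, e₁.sem = e₂.sem → GKAT.GEquiv e₁ e₂) :=
  ⟨fun _ _ h _ hR hU => hU.of_sem_eq hR h,
    fun hU _ _ h => hU.of_sem_eq GKAT.isGKATCongruence_gEquiv h⟩
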